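/- Let $p$ be a prime. For rational numbers $x,y$ write $x\equiv y \pmod{p^2}$ if $x-y=p^2r$ for some rational $r$ whose denominator is not divisible by $p$. (i) If $p\equiv 3\pmod 4$, then $$\sum_{k=0}^{p-1}\binom{p-1}{k}\binom{2k}{k}^2\frac{1}{(-8)^k}\equiv 0\pmod{p^2}.$$ (ii) If $p\equiv 1\pmod{12}$, then $$\sum_{k=0}^{p-1}\binom{p-1}{k}\binom{2k}{k}^2\frac{\chi_3(k)}{16^k}\equiv 0\pmod{p^2},$$ where $\chi_3(k)=\left(\frac{k}{3}\right)$ is the Legendre symbol. (iii) If $p\equiv 7\pmod 8$, then $$\sum_{k=0}^{p-1}\binom{p-1}{k}\binom{2k}{k}^2\frac{P_k}{8^k}\equiv 0\pmod{p^2},$$ where the Pell numbers $P_k$ are given by $P_0=0$, $P_1=1$, $P_n=2P_{n-1}+P_{n-2}$ for $n\ge 2$. (iv) If $p\equiv 11\pmod{12}$, then $$\sum_{k=0}^{p-1}\binom{p-1}{k}\binom{2k}{k}^2\frac{R_k}{(-4)^k}\equiv 0\pmod{p^2},$$ where $R_0=2$, $R_1=4$, $R_n=4R_{n-1}-R_{n-2}$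 for $n\ge 2$. -/

import Mathlib

/-- Congruence of rational numbers modulo `n`: `x ≡ y (mod n)` if `x - y = n * r` for some
rational `r` whose denominator is prime to `n`. -/
def RatModEq (n : ℕ) (x y : ℚ) : Prop :=
  ∃ r : ℚ, r.den.Coprime n ∧ x - y = (n : ℚ) * r

/-- The Pell numbers `0, 1, 2, 5, 12, …`. -/
def pellNumber : ℕ → ℤ
  | 0 => 0
  | 1 => 1
  | n + 2 => 2 * pellNumber (n + 1) + pellNumber n

/-- The sequence `R` with `R 0 = 2`, `R 1 = 4`, `R n = 4 R (n - 1) - R (n - 2)`. -/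
def seqR : ℕ → ℤ
  | 0 => 2
  | 1 => 4
  | n + 2 => 4 * seqR (n + 1) - seqR n

/-- The binomial sum `∑_{k=0}^{p-1} C(p-1,k) C(2k,k)^2 a_k`. -/
def binomSum (p : ℕ) (a : ℕ → ℚ) : ℚ :=
  ∑ k ∈ Finset.range p, ((p - 1).choose k : ℚ) * ((2 * k).choose k : ℚ) ^ 2 * a k

/-! Write p = 2n+1. Modulo p², the product C(p-1,k) C(2k,k)² / 16^k agrees with C(n,k) (n+1)_k /
(2n+2)_k for k ≤ n, and vanishes for n < k < p. Sums weighted by s_k / (-16)^k, with s_k a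
combination of powers z^k, thus become combinations of values of F(z) = ₂F₁(-n, n+1; 2n+2; z), of
which `betaPoly` is a multiple by a unit.

F(z) is proportional to ∫ t^n (1-t)^n (1-zt)^n dt over [0,1], so the symmetry t ↦ 1-t gives the
Pfaff relation F(z) = (1-z)^n F(z/(z-1)). In each case s_k comes from a fixed point z, or a pair z,
w exchanged by z ↦ z/(z-1). In (i), z = 2 and F(2) = -F(2). In (ii), z and w are primitive sixth
roots of unity and F(z) = F(w).

In (iii) and (iv) the sum becomes a product ((1-z)^n ∓ 1) F(w). The first factor is divisible by p
by Fermat, as 1-z is ± a square. So is the second: modulo p, F is proportional to the Hasse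
polynomial ∑ C(n,k)² z^k, and w is a supersingular Legendre parameter. That vanishing follows from
Landen's transformation and the symmetries of λ (`hassePoly_sqrt_two`, `hassePoly_sqrt_three`). -/

/-! ### Beta moments and the Pfaff transformation. -/

/-- `(n+1)_i (n+1)_j (2n+2+i+j)_{n-i-j}`, the moments of `t^i (1-t)^j` against the symmetric beta
weight `t^n (1-t)^n`, cleared of denominators. -/
def betaMoment (n i j : ℕ) : ℕ :=
  (n + 1).ascFactorial i * (n + 1).ascFactorial j *
    (2 * n + 2 + i + j).ascFactorial (n - i - j)

theorem betaMoment_comm (n i j : ℕ) : betaMoment n i j = betaMoment n j i := by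
  unfold betaMoment
  rw [Nat.sub_right_comm, show 2 * n + 2 + i + j = 2 * n + 2 + j + i by ring]
  ring

/-- This is t + (1-t) = 1 on moments: raising i or j drops the factor 2n+2+i+j from the last
product, and (n+1+i) + (n+1+j) restores it. -/
theorem betaMoment_succ_add_succ {n i j : ℕ} (h : i + j < n) :
    betaMoment n (i + 1) j + betaMoment n i (j + 1) = betaMoment n i j := by
  obtain ⟨m, rfl⟩ : ∃ m, n = i + j + (m + 1) := ⟨n - i - j - 1, by omega⟩
  unfold betaMoment
  rw [show i + j + (m + 1) - (i + 1) - j = m by omega,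
    show i + j + (m + 1) - i - (j + 1) = m by omega,
    show i + j + (m + 1) - i - j = m + 1 by omega]
  generalize hn : i + j + (m + 1) = n
  rw [show 2 * n + 2 + (i + 1) + j = (2 * n + 2 + i + j) + 1 by ring,
    show 2 * n + 2 + i + (j + 1) = (2 * n + 2 + i + j) + 1 by ring,
    Nat.ascFactorial_succ (k := i), Nat.ascFactorial_succ (k := j), add_comm m 1,
    ← Nat.ascFactorial_mul_ascFactorial (2 * n + 2 + i + j) 1 m, Nat.ascFactorial_succ (k := 0),
    Nat.ascFactorial_zero]
  ring

/-- Expanding `(1 - z t)^m = ((1 - z) + z (1 - t))^m` under a linear functional with moments `U`. -/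
theorem sum_choose_moment {R : Type*} [CommRing R] (U : ℕ → ℕ → R) (N : ℕ)
    (hU : ∀ i j, i + j < N → U (i + 1) j + U i (j + 1) = U i j) (z : R) (m : ℕ) :
    ∀ i j, i + j + m ≤ N →
      ∑ k ∈ Finset.range (m + 1), (m.choose k : R) * (-z) ^ k * U (i + k) j =
        ∑ k ∈ Finset.range (m + 1), (m.choose k : R) * ((1 - z) ^ (m - k) * z ^ k) * U i (j + k) := by
  have pascal : ∀ (m : ℕ) (f : ℕ → R),
      ∑ k ∈ Finset.range (m + 2), ((m + 1).choose k : R) * f k =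
        ∑ k ∈ Finset.range (m + 1), (m.choose k : R) * f k +
          ∑ k ∈ Finset.range (m + 1), (m.choose k : R) * f (k + 1) := by
    intro m f
    rw [Finset.sum_range_succ' _ (m + 1)]
    simp only [Nat.choose_succ_succ, Nat.cast_add, add_mul, Finset.sum_add_distrib]
    rw [Finset.sum_range_succ' (fun k => (m.choose k : R) * f k) m,
      Finset.sum_range_succ (fun k => (m.choose (k + 1) : R) * f (k + 1)) m]
    simp
    ring
  induction m with
  | zero => intro i j _; simp
  | succ m ih =>
    intro i j h
    have e1 : ∑ k ∈ Finset.range (m + 1 + 1), ((m + 1).choose k : R) * (-z) ^ k * U (i + k) j =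
        (∑ k ∈ Finset.range (m + 1), (m.choose k : R) * (-z) ^ k * U (i + k) j) -
          z * ∑ k ∈ Finset.range (m + 1), (m.choose k : R) * (-z) ^ k * U (i + 1 + k) j := by
      simp only [mul_assoc]
      rw [pascal m fun k => (-z) ^ k * U (i + k) j, sub_eq_add_neg, ← neg_mul, Finset.mul_sum]
      congr 1
      refine Finset.sum_congr rfl fun k _ => ?_
      rw [show i + 1 + k = i + (k + 1) by ring]
      ring
    have e2 : ∑ k ∈ Finset.range (m + 1 + 1),
          ((m + 1).choose k : R) * ((1 - z) ^ (m + 1 - k) * z ^ k) * U i (j + k) =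
        (1 - z) * (∑ k ∈ Finset.range (m + 1),
          (m.choose k : R) * ((1 - z) ^ (m - k) * z ^ k) * U i (j + k)) +
        z * ∑ k ∈ Finset.range (m + 1),
          (m.choose k : R) * ((1 - z) ^ (m - k) * z ^ k) * U i (j + 1 + k) := by
      simp only [mul_assoc]
      rw [pascal m fun k => (1 - z) ^ (m + 1 - k) * (z ^ k * U i (j + k)), Finset.mul_sum,
        Finset.mul_sum]
      congr 1
      · refine Finset.sum_congr rfl fun k hk => ?_
        rw [Nat.succ_sub (Finset.mem_range_succ_iff.mp hk), pow_succ]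
        ring
      · refine Finset.sum_congr rfl fun k _ => ?_
        rw [show j + 1 + k = j + (k + 1) by ring, Nat.add_sub_add_right]
        ring
    have e3 : ∑ k ∈ Finset.range (m + 1), (m.choose k : R) * (-z) ^ k * U (i + k) j =
        (∑ k ∈ Finset.range (m + 1), (m.choose k : R) * (-z) ^ k * U (i + 1 + k) j) +
          ∑ k ∈ Finset.range (m + 1), (m.choose k : R) * (-z) ^ k * U (i + k) (j + 1) := by
      rw [← Finset.sum_add_distrib]
      refine Finset.sum_congr rfl fun k hk => ?_
      have := Finset.mem_range_succ_iff.mp hk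
      rw [← hU (i + k) j (by omega), show i + 1 + k = i + k + 1 by ring]
      ring
    rw [e1, e2, ← ih i j (by omega), ← ih i (j + 1) (by omega)]
    linear_combination z * e3

/-- The polynomial `∑ C(n,k) (n+1)_k (2n+2+k)_{n-k} (-z)^k`, a multiple of
`₂F₁(-n, n+1; 2n+2; z)`. -/
def betaPoly {R : Type*} [CommRing R] (n : ℕ) (z : R) : R :=
  ∑ k ∈ Finset.range (n + 1), (n.choose k : R) * (-z) ^ k * (betaMoment n k 0 : R)

/-- The Pfaff transformation `z ↦ z / (z - 1)`. -/
theorem betaPoly_pfaff {R : Type*} [CommRing R] (n : ℕ) {z w : R} (h : z = w * (z - 1)) :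
    betaPoly n z = (1 - z) ^ n * betaPoly n w := by
  have key := sum_choose_moment (fun i j => (betaMoment n i j : R)) n
    (fun i j hij => by exact_mod_cast congrArg (Nat.cast (R := R)) (betaMoment_succ_add_succ hij))
    z n 0 0 (by omega)
  simp only [zero_add] at key
  unfold betaPoly
  rw [key, Finset.mul_sum]
  refine Finset.sum_congr rfl fun k hk => ?_
  have hk := Finset.mem_range_succ_iff.mp hk
  have e : (1 - z) ^ n = (1 - z) ^ (n - k) * (1 - z) ^ k := by rw [← pow_add, Nat.sub_add_cancel hk]
  have e' : z ^ k = (-w) ^ k * (1 - z) ^ k := by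
    rw [← mul_pow]; congr 1; linear_combination h
  rw [betaMoment_comm, e, e']
  ring

theorem map_betaPoly {R S : Type*} [CommRing R] [CommRing S] (f : R →+* S) (n : ℕ) (z : R) :
    f (betaPoly n z) = betaPoly n (f z) := by
  simp [betaPoly]

/-! ### Reduction of the binomial sum modulo p². -/

theorem cast_choose_succ {R : Type*} [CommRing R] {n k : ℕ} (h : k ≤ n) :
    (n.choose (k + 1) : R) * (k + 1) = n.choose k * (n - k) := by
  have := congrArg (Nat.cast (R := R)) (Nat.choose_succ_right_eq n k)
  push_cast [Nat.cast_sub h] at this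
  exact this

theorem cast_centralBinom_succ (R : Type*) [CommRing R] (k : ℕ) :
    ((k : R) + 1) * (k + 1).centralBinom = 2 * (2 * k + 1) * k.centralBinom := by
  exact_mod_cast congrArg (Nat.cast (R := R)) (Nat.succ_mul_centralBinom_succ k)

/-- The coefficientwise congruence modulo `p ^ 2`, where `p = 2 * n + 1`. -/
theorem choose_mul_centralBinom_sq {R : Type*} [CommRing R] {n : ℕ}
    (hp : (2 * n + 1 : R) ^ 2 = 0) (hu : ∀ j : ℕ, 0 < j → j ≤ n → IsUnit (j : R)) :
    ∀ k ≤ n, ((2 * n).choose k : R) * (k.centralBinom : R) ^ 2 * ((2 * n + 2).ascFactorial k : R) =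
      16 ^ k * (n.choose k : R) * ((n + 1).ascFactorial k : R) := by
  intro k
  induction k with
  | zero => simp
  | succ k ih =>
    intro hk
    have ih := ih (by omega)
    have c1 := cast_choose_succ (R := R) (show k ≤ 2 * n by omega)
    have c2 := cast_choose_succ (R := R) (show k ≤ n by omega)
    have c3 := cast_centralBinom_succ R k
    have u : IsUnit ((k + 1 : ℕ) : R) := hu _ (by omega) hk
    -- One factor k+1 for the step in C(2n,k), two for the squared central binomial.
    rw [← (u.pow 3).mul_left_inj]
    rw [Nat.ascFactorial_succ, Nat.ascFactorial_succ]
    push_cast at *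
    set a : R := ((2 * n).choose k : R)
    set a' : R := ((2 * n).choose (k + 1) : R)
    set b : R := (k.centralBinom : R)
    set b' : R := ((k + 1).centralBinom : R)
    set c : R := (n.choose k : R)
    set c' : R := (n.choose (k + 1) : R)
    set d : R := ((2 * n + 2).ascFactorial k : R)
    set e : R := ((n + 1).ascFactorial k : R)
    calc a' * b' ^ 2 * ((2 * n + 2 + k) * d) * (k + 1 : R) ^ 3
        = (a' * (k + 1)) * ((k + 1) * b') ^ 2 * ((2 * n + 2 + k) * d) := by ring
      _ = (a * b ^ 2 * d) * (4 * (2 * k + 1) ^ 2 * ((2 * n + 1) ^ 2 - (k + 1) ^ 2)) := by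
          rw [c1, c3]; ring
      -- As p² = 0, both sides reduce to the multiple -4(2k+1)²(k+1)². This is the only place where
      -- the coefficients agree just modulo p².
      _ = 16 ^ k * c * e * (4 * ((2 * n + 1) ^ 2 - (2 * k + 1) ^ 2) * (k + 1) ^ 2) := by
          rw [ih, hp]; ring
      _ = 16 ^ (k + 1) * (c * (n - k)) * ((n + 1 + k) * e) * (k + 1) ^ 2 := by ring
      _ = _ := by rw [← c2]; ring

theorem choose_mul_centralBinom_sq_mul_betaMoment {R : Type*} [CommRing R] {n : ℕ}
    (hp : (2 * n + 1 : R) ^ 2 = 0) (hu : ∀ j : ℕ, 0 < j → j ≤ n → IsUnit (j : R)) {k : ℕ}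
    (hk : k ≤ n) :
    ((2 * n).choose k : R) * (k.centralBinom : R) ^ 2 * (betaMoment n 0 0 : R) =
      16 ^ k * (n.choose k : R) * (betaMoment n k 0 : R) := by
  have h := choose_mul_centralBinom_sq hp hu k hk
  have e : (2 * n + 2).ascFactorial n =
      (2 * n + 2).ascFactorial k * (2 * n + 2 + k).ascFactorial (n - k) := by
    rw [Nat.ascFactorial_mul_ascFactorial, Nat.add_sub_cancel' hk]
  simp only [betaMoment, Nat.ascFactorial_zero, add_zero, Nat.sub_zero, one_mul, mul_one, e]
  push_cast
  linear_combination ((2 * n + 2 + k).ascFactorial (n - k) : R) * h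

theorem betaMoment_zero_zero (n : ℕ) : betaMoment n 0 0 = (2 * n + 2).ascFactorial n := by
  simp [betaMoment]

/-- The factors are p+1, …, p+n, congruent to 1, …, n modulo p. -/
theorem coprime_betaMoment_zero_zero {n : ℕ} (hp : (2 * n + 1).Prime) :
    (betaMoment n 0 0).Coprime (2 * n + 1) := by
  rw [betaMoment_zero_zero]
  have : ∀ m ≤ n, ((2 * n + 2).ascFactorial m).Coprime (2 * n + 1) := by
    intro m
    induction m with
    | zero => simp
    | succ m ih =>
      intro hm
      rw [Nat.ascFactorial_succ]
      refine Nat.Coprime.mul_left ?_ (ih (by omega))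
      rw [show 2 * n + 2 + m = (m + 1) + (2 * n + 1) by ring, Nat.coprime_add_self_left]
      exact (Nat.coprime_of_lt_prime (by omega) (by omega) hp).symm
  exact this n le_rfl

theorem isUnit_natCast_zmod_sq {p a : ℕ} (h : a.Coprime p) : IsUnit (a : ZMod (p ^ 2)) :=
  (ZMod.isUnit_iff_coprime _ _).mpr (h.pow_right 2)

theorem natCast_self_sq_zmod_sq (p : ℕ) : (p : ZMod (p ^ 2)) ^ 2 = 0 := by
  rw [← Nat.cast_pow, ZMod.natCast_self]

/-- Multiplying by 16^(2n) makes the sum integral. The terms with n < k < p drop out because p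
divides C(2k,k), which occurs squared. -/
theorem betaMoment_mul_sum {n : ℕ} (hp : (2 * n + 1).Prime) (s : ℕ → ℤ) :
    (betaMoment n 0 0 : ZMod ((2 * n + 1) ^ 2)) * ((∑ k ∈ Finset.range (2 * n + 1),
      ((2 * n).choose k : ℤ) * ((2 * k).choose k : ℤ) ^ 2 * (s k * (-16) ^ (2 * n - k)) : ℤ) :
        ZMod ((2 * n + 1) ^ 2)) =
    16 ^ (2 * n) * ∑ k ∈ Finset.range (n + 1),
      (n.choose k : ZMod ((2 * n + 1) ^ 2)) * (-1) ^ k * (betaMoment n k 0 : ZMod _) * (s k : ZMod ((2 * n + 1) ^ 2)) := by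
  have hP : (2 * n + 1 : ZMod ((2 * n + 1) ^ 2)) ^ 2 = 0 := by
    exact_mod_cast natCast_self_sq_zmod_sq (2 * n + 1)
  have hu : ∀ j : ℕ, 0 < j → j ≤ n → IsUnit (j : ZMod ((2 * n + 1) ^ 2)) := fun j h0 hj =>
    isUnit_natCast_zmod_sq (Nat.coprime_of_lt_prime (by omega) (by omega) hp).symm
  push_cast
  rw [Finset.mul_sum, Finset.mul_sum, ← Finset.sum_subset
    (Finset.range_mono (show n + 1 ≤ 2 * n + 1 by omega))]
  · refine Finset.sum_congr rfl fun k hk => ?_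
    have hk := Finset.mem_range_succ_iff.mp hk
    have h := choose_mul_centralBinom_sq_mul_betaMoment hP hu hk
    rw [Nat.centralBinom_eq_two_mul_choose] at h
    have e : (16 : ZMod ((2 * n + 1) ^ 2)) ^ (2 * n) = 16 ^ k * 16 ^ (2 * n - k) := by
      rw [← pow_add]; congr 1; omega
    have e' : (-16 : ZMod ((2 * n + 1) ^ 2)) ^ (2 * n - k) = (-1) ^ k * 16 ^ (2 * n - k) := by
      rw [neg_pow]
      congr 1
      have h1 : (-1 : ZMod ((2 * n + 1) ^ 2)) ^ (2 * n - k) * (-1) ^ k = 1 := by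
        rw [← pow_add, Nat.sub_add_cancel (by omega), pow_mul]; simp
      have h2 : (-1 : ZMod ((2 * n + 1) ^ 2)) ^ k * (-1) ^ k = 1 := by
        rw [← mul_pow]; simp
      linear_combination (-1) ^ k * h1 - (-1) ^ (2 * n - k) * h2
    rw [e, e']
    linear_combination ((-1) ^ k * 16 ^ (2 * n - k) * (s k : ZMod ((2 * n + 1) ^ 2))) * h
  · intro k hk hk'
    simp only [Finset.mem_range, not_lt] at hk hk'
    obtain ⟨m, hm⟩ := hp.dvd_choose (a := k) (b := 2 * k) (by omega) (by omega) (by omega)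
    have : ((2 * k).choose k : ZMod ((2 * n + 1) ^ 2)) ^ 2 = 0 := by
      rw [hm]; push_cast; rw [mul_pow, hP, zero_mul]
    rw [this]; ring

/-- The binomial sum vanishes modulo `p ^ 2` as soon as the corresponding
combination of values of `betaPoly` does. -/
theorem ratModEq_binomSum {n : ℕ} (hp : (2 * n + 1).Prime) (a : ℕ → ℚ) (s : ℕ → ℤ)
    (ha : ∀ k, a k = s k / (-16) ^ k)
    (h : ∑ k ∈ Finset.range (n + 1), (n.choose k : ZMod ((2 * n + 1) ^ 2)) * (-1) ^ k *
      (betaMoment n k 0 : ZMod _) * (s k : ZMod ((2 * n + 1) ^ 2)) = 0) :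
    RatModEq ((2 * n + 1) ^ 2) (binomSum (2 * n + 1) a) 0 := by
  have key := betaMoment_mul_sum hp s
  rw [h, mul_zero, (isUnit_natCast_zmod_sq (coprime_betaMoment_zero_zero hp)).mul_right_eq_zero,
    ZMod.intCast_zmod_eq_zero_iff_dvd] at key
  obtain ⟨M, hM⟩ := key
  have hsum : binomSum (2 * n + 1) a * (-16) ^ (2 * n) =
      ((∑ k ∈ Finset.range (2 * n + 1),
        ((2 * n).choose k : ℤ) * ((2 * k).choose k : ℤ) ^ 2 * (s k * (-16) ^ (2 * n - k)) : ℤ) :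
        ℚ) := by
    unfold binomSum
    push_cast
    rw [Finset.sum_mul]
    refine Finset.sum_congr rfl fun k hk => ?_
    have e : (-16 : ℚ) ^ (2 * n) = (-16) ^ k * (-16) ^ (2 * n - k) := by
      rw [← pow_add]; congr 1; have := Finset.mem_range.mp hk; omega
    rw [ha, e]
    field_simp
  -- The common denominator is (-16)^(2n) = 2^(8n), prime to the odd modulus.
  refine ⟨(M : ℚ) / ((2 ^ (8 * n) : ℤ) : ℚ), ?_, ?_⟩
  · have h1 := Rat.den_dvd M (2 ^ (8 * n))
    rw [Rat.divInt_eq_div] at h1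
    have h2 : ((M : ℚ) / ((2 ^ (8 * n) : ℤ) : ℚ)).den ∣ 2 ^ (8 * n) := by exact_mod_cast h1
    refine Nat.Coprime.coprime_dvd_left h2 (Nat.Coprime.pow _ _ ?_)
    simp
  · rw [hM] at hsum
    have e : ((2 ^ (8 * n) : ℤ) : ℚ) = (-16) ^ (2 * n) := by
      rw [Even.neg_pow ⟨n, by ring⟩]
      push_cast
      rw [show (16 : ℚ) = 2 ^ 4 by norm_num, ← pow_mul]
      congr 1; ring
    rw [e, sub_zero, ← mul_div_assoc, eq_div_iff (by positivity), hsum]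
    push_cast
    ring

/-! ### The Hasse polynomial in characteristic p and its transformations. -/

/-- The polynomial `∑ C(n,k)^2 z^k`, which modulo `p = 2 * n + 1` is the Hasse invariant of the
Legendre curve. -/
def hassePoly {R : Type*} [CommRing R] (n : ℕ) (z : R) : R :=
  ∑ k ∈ Finset.range (n + 1), (n.choose k : R) ^ 2 * z ^ k

/-- Here 2n+2 = 1 and n+1 = -n, so the rising factorials turn into (k+1)_{n-k} = n!/k! and, up to
sign, a falling factorial of n. -/
theorem cast_betaMoment_of_two_mul_add_one_eq_zero {R : Type*} [CommRing R] {n k : ℕ}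
    (hp : (2 * n + 1 : R) = 0) (hk : k ≤ n) :
    (betaMoment n k 0 : R) = (-1) ^ k * (n.factorial * n.choose k) := by
  have h1 : ∀ m : ℕ, ((2 * n + 2 + k).ascFactorial m : R) = ((k + 1).ascFactorial m : R) := by
    intro m
    induction m with
    | zero => simp
    | succ m ih =>
      rw [Nat.ascFactorial_succ, Nat.ascFactorial_succ]
      push_cast
      rw [ih]
      linear_combination ((k + 1).ascFactorial m : R) * hp
  have h2 : ∀ m ≤ n, ((n + 1).ascFactorial m : R) = (-1) ^ m * (n.descFactorial m : R) := by
    intro m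
    induction m with
    | zero => simp
    | succ m ih =>
      intro hm
      rw [Nat.ascFactorial_succ, Nat.descFactorial_succ]
      push_cast [Nat.cast_sub (show m ≤ n by omega)]
      rw [ih (by omega)]
      linear_combination ((-1) ^ m * (n.descFactorial m : R)) * hp
  have h3 := congrArg (Nat.cast (R := R)) (Nat.factorial_mul_ascFactorial k (n - k))
  rw [Nat.add_sub_cancel' hk] at h3
  simp only [betaMoment, Nat.ascFactorial_zero, add_zero, Nat.sub_zero, mul_one]
  push_cast at h3 ⊢
  rw [h1, h2 k hk, Nat.descFactorial_eq_factorial_mul_choose, ← h3]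
  push_cast
  ring

theorem betaPoly_eq_factorial_mul_hassePoly {R : Type*} [CommRing R] {n : ℕ}
    (hp : (2 * n + 1 : R) = 0) (z : R) : betaPoly n z = n.factorial * hassePoly n z := by
  unfold betaPoly hassePoly
  rw [Finset.mul_sum]
  refine Finset.sum_congr rfl fun k hk => ?_
  rw [cast_betaMoment_of_two_mul_add_one_eq_zero hp (Finset.mem_range_succ_iff.mp hk), neg_pow z]
  have : (-1 : R) ^ k * (-1) ^ k = 1 := by rw [← mul_pow]; simp
  linear_combination (n.choose k : R) ^ 2 * z ^ k * n.factorial * this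

/-- The coefficients C(n,k)² are palindromic. -/
theorem hassePoly_inv {K : Type*} [Field K] (n : ℕ) {z : K} (hz : z ≠ 0) :
    hassePoly n z = z ^ n * hassePoly n z⁻¹ := by
  unfold hassePoly
  rw [← Finset.sum_range_reflect, Finset.mul_sum]
  refine Finset.sum_congr rfl fun k hk => ?_
  have hk := Finset.mem_range_succ_iff.mp hk
  rw [show n + 1 - 1 - k = n - k by omega, Nat.choose_symm hk, pow_sub₀ _ hz hk, inv_pow]
  ring

/-- C(2k,k) = (-4)^k C(-1/2,k), and n = -1/2 in characteristic p. -/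
theorem centralBinom_eq_neg_four_pow_mul_choose {K : Type*} [Field K] {n : ℕ}
    (hp : (2 * n + 1 : K) = 0) (hu : ∀ j : ℕ, 0 < j → j ≤ n → (j : K) ≠ 0) :
    ∀ k ≤ n, (k.centralBinom : K) = (-4) ^ k * n.choose k := by
  intro k
  induction k with
  | zero => simp
  | succ k ih =>
    intro hk
    have u := hu (k + 1) (by omega) hk
    have c2 := cast_choose_succ (R := K) (show k ≤ n by omega)
    have c3 := cast_centralBinom_succ K k
    rw [ih (by omega)] at c3
    push_cast at u
    apply mul_left_cancel₀ u
    rw [c3, pow_succ]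
    linear_combination (-4) ^ k * (4 * c2) + 2 * (-4) ^ k * (n.choose k : K) * hp

open Polynomial in
/-- Landen's transformation `₂F₁(-n, 1/2; 1; 4x/(1+x)²) (1+x)^(2n) = ₂F₁(-n, -n; 1; x²)`. -/
theorem sum_choose_mul_centralBinom {R : Type*} [CommRing R] (n : ℕ) (x : R) :
    ∑ j ∈ Finset.range (n + 1), (n.choose j : R) * j.centralBinom * (-x) ^ j *
      (1 + x) ^ (2 * (n - j)) = hassePoly n (x ^ 2) := by
  -- Both sides of the Landen identity are the coefficient of X^n in (1-xX)^n (X-x)^n, since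
  -- (1-xX)(X-x) = -x(1+X)² + (1+x)²X.
  have key : (C (-x) * (1 + X) ^ 2 + X * C ((1 + x) ^ 2)) ^ n =
      (1 + C (-x) * X) ^ n * (X + C (-x)) ^ n := by
    rw [← mul_pow]
    congr 1
    simp only [C_neg, C_pow, C_add, C_1]
    ring
  have h := congrArg (fun q : R[X] => q.coeff n) key
  rw [add_pow, finsetSum_coeff, coeff_mul, Finset.Nat.sum_antidiagonal_eq_sum_range_succ_mk] at h
  unfold hassePoly
  convert h using 1
  · refine Finset.sum_congr rfl fun j hj => ?_
    have hj := Finset.mem_range_succ_iff.mp hj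
    have e : (C (-x) * (1 + X) ^ 2) ^ j * (X * C ((1 + x) ^ 2)) ^ (n - j) * ((n.choose j : ℕ) : R[X])
        = C ((n.choose j : R) * (-x) ^ j * (1 + x) ^ (2 * (n - j))) *
          ((1 + X) ^ (2 * j) * X ^ (n - j)) := by
      simp only [C_mul, C_pow, C_neg, C_add, C_1, mul_pow, pow_mul, map_natCast]
      ring
    rw [e, coeff_C_mul, coeff_mul_X_pow', if_pos (by omega), Nat.sub_sub_self hj,
      coeff_one_add_X_pow, Nat.centralBinom_eq_two_mul_choose]
    ring
  · refine Finset.sum_congr rfl fun j hj => ?_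
    have hj := Finset.mem_range_succ_iff.mp hj
    have e : ((1 + C (-x) * X) ^ n : R[X]) = ((1 + X) ^ n).comp (C (-x) * X) := by simp
    rw [e, comp_C_mul_X_coeff, coeff_one_add_X_pow, coeff_X_add_C_pow, Nat.sub_sub_self hj,
      Nat.choose_symm hj]
    dsimp only
    rw [← neg_sq x]
    generalize -x = y
    ring

/-- The Landen transformation in characteristic `p = 2 * n + 1`. -/
theorem hassePoly_landen {K : Type*} [Field K] {n : ℕ}
    (hp : (2 * n + 1 : K) = 0) (hu : ∀ j : ℕ, 0 < j → j ≤ n → (j : K) ≠ 0) {x z : K}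
    (hz : z * (1 + x) ^ 2 = 4 * x) :
    (1 + x) ^ (2 * n) * hassePoly n z = hassePoly n (x ^ 2) := by
  rw [← sum_choose_mul_centralBinom, hassePoly, Finset.mul_sum]
  refine Finset.sum_congr rfl fun j hj => ?_
  have hj := Finset.mem_range_succ_iff.mp hj
  rw [centralBinom_eq_neg_four_pow_mul_choose hp hu j hj]
  have e : (1 + x) ^ (2 * n) = (1 + x) ^ (2 * (n - j)) * ((1 + x) ^ 2) ^ j := by
    rw [← pow_mul, ← pow_add]; congr 1; omega
  have e' : z ^ j * ((1 + x) ^ 2) ^ j = (-4) ^ j * (-x) ^ j := by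
    rw [← mul_pow, ← mul_pow, hz]; congr 1; ring
  rw [e]
  linear_combination ((1 + x) ^ (2 * (n - j)) * (n.choose j : K) ^ 2) * e'

theorem hassePoly_pfaff {K : Type*} [Field K] {n : ℕ}
    (hp : (2 * n + 1 : K) = 0) (hu : ∀ j : ℕ, 0 < j → j ≤ n → (j : K) ≠ 0) {z w : K}
    (h : z = w * (z - 1)) : hassePoly n z = (1 - z) ^ n * hassePoly n w := by
  have hf : ∀ m ≤ n, (m.factorial : K) ≠ 0 := by
    intro m
    induction m with
    | zero => simp
    | succ m ih =>
      intro hm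
      rw [Nat.factorial_succ, Nat.cast_mul]
      exact mul_ne_zero (hu _ (by omega) hm) (ih (by omega))
  have := betaPoly_pfaff n h
  rw [betaPoly_eq_factorial_mul_hassePoly hp, betaPoly_eq_factorial_mul_hassePoly hp] at this
  apply mul_left_cancel₀ (hf n le_rfl)
  linear_combination this

/-- The substitution λ ↦ 1-λ is composed of Pfaff, inversion and Pfaff again. -/
theorem hassePoly_one_sub {K : Type*} [Field K] {n : ℕ}
    (hp : (2 * n + 1 : K) = 0) (hu : ∀ j : ℕ, 0 < j → j ≤ n → (j : K) ≠ 0) {z : K}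
    (h0 : z ≠ 0) (h1 : z ≠ 1) : hassePoly n (1 - z) = (-1) ^ n * hassePoly n z := by
  have h2 : z - 1 ≠ 0 := sub_ne_zero.mpr h1
  have e1 := hassePoly_pfaff hp hu (z := 1 - z) (w := ((z - 1) / z)) (by field_simp; ring)
  have e2 := hassePoly_inv n (z := (z - 1) / z) (div_ne_zero h2 h0)
  have e3 := hassePoly_pfaff hp hu (z := z) (w := ((z - 1) / z)⁻¹) (by field_simp)
  rw [e1, e2, e3, show 1 - (1 - z) = z by ring, show 1 - z = -1 * (z - 1) by ring, mul_pow,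
    div_pow]
  have : (-1 : K) ^ n * (-1) ^ n = 1 := by rw [← mul_pow]; simp
  have hz : z ^ n ≠ 0 := pow_ne_zero _ h0
  rw [← mul_assoc, ← mul_assoc, ← mul_assoc, this, one_mul, mul_div_cancel₀ _ hz]

/-! ### Two supersingular parameters. -/

/-- Supersingularity of the Legendre curve at `λ = 2 (√2 - 1)` for `p ≡ 7 mod 8`. -/
theorem hassePoly_sqrt_two {K : Type*} [Field K] {n : ℕ}
    (hp : (2 * n + 1 : K) = 0) (hu : ∀ j : ℕ, 0 < j → j ≤ n → (j : K) ≠ 0) (hn : Odd n)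
    {r : K} (hr : r ^ 2 = 2) (hr1 : r ^ (2 * n) = 1) : hassePoly n (2 * (r - 1)) = 0 := by
  have h2 : (2 : K) ≠ 0 := by
    intro h
    rw [h] at hp
    simp at hp
  have hr2 : r - 1 ≠ 0 := by
    intro h
    apply one_ne_zero (α := K)
    linear_combination -hr + (r + 1) * h
  -- With x = √2 - 1 and λ = 4x/(1+x)², one has x² = 1 - λ. Landen followed by λ ↦ 1-λ then returns
  -- to λ with sign (-1)^n = -1.
  have hL := hassePoly_landen hp hu (x := r - 1) (z := 2 * (r - 1))
    (by linear_combination 2 * (r - 1) * hr)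
  rw [add_sub_cancel, hr1, one_mul, show (r - 1) ^ 2 = 1 - 2 * (r - 1) by linear_combination hr,
    hassePoly_one_sub hp hu (mul_ne_zero h2 hr2), hn.neg_one_pow] at hL
  · apply mul_left_cancel₀ h2
    linear_combination hL
  · intro h
    apply hr2
    apply pow_eq_zero_iff (two_ne_zero) |>.mp
    linear_combination hr - h

/-- Supersingularity of the Legendre curve at `λ = 4 (2 - √3)` for `p ≡ 11 mod 12`. -/
theorem hassePoly_sqrt_three {K : Type*} [Field K] [IsAlgClosed K] {n : ℕ}
    (hp : (2 * n + 1 : K) = 0) (hu : ∀ j : ℕ, 0 < j → j ≤ n → (j : K) ≠ 0) (hn : n % 6 = 5)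
    {r : K} (hr : r ^ 2 = 3) : hassePoly n (4 * (2 - r)) = 0 := by
  have h2 : (2 : K) ≠ 0 := by
    intro h
    rw [h] at hp
    simp at hp
  have h3 : (3 : K) ≠ 0 := by exact_mod_cast hu 3 (by omega) (by omega)
  obtain ⟨i, hi⟩ := IsAlgClosed.exists_pow_nat_eq (-1 : K) (n := 2) (by norm_num)
  -- k = (√3 + i)/2 is a primitive twelfth root of unity, so k + 1/k = √3 and 4k/(1+k)² = 4/(2+√3) =
  -- 4(2-√3). Landen leads from this λ to the sixth root of unity q = k².
  obtain ⟨k, hk⟩ : ∃ k : K, 2 * k = r + i := ⟨(r + i) / 2, by field_simp⟩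
  have hkr : k ^ 2 + 1 = r * k := by
    apply mul_left_cancel₀ h2
    apply mul_left_cancel₀ h2
    linear_combination (2 * k + (r + i) - 2 * r) * hk + hi - hr
  obtain ⟨q, hq⟩ : ∃ q, q = k ^ 2 := ⟨_, rfl⟩
  have hq1 : q ^ 2 - q + 1 = 0 := by
    rw [hq]; linear_combination (k ^ 2 + 1 + r * k) * hkr + k ^ 2 * hr
  have hq3 : q ^ 3 = -1 := by linear_combination (q + 1) * hq1
  have hq0 : q ≠ 0 := by rintro rfl; simp at hq1
  have hinv : q⁻¹ = 1 - q := by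
    apply inv_eq_of_mul_eq_one_right
    linear_combination -hq1
  -- Pfaff and inversion both relate q to q⁻¹, with factors q and -q² respectively; these differ, so
  -- the value is zero.
  have hA : hassePoly n q = 0 := by
    have e1 := hassePoly_pfaff hp hu (z := q) (w := q⁻¹) (by rw [hinv]; linear_combination hq1)
    have e2 := hassePoly_inv n hq0
    obtain ⟨m, hm⟩ : ∃ m, n = 6 * m + 5 := ⟨n / 6, by omega⟩
    have p1 : q ^ n = -q ^ 2 := by
      rw [hm, pow_add, show 6 * m = 3 * (2 * m) by ring, pow_mul, pow_mul, hq3]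
      simp
      linear_combination q ^ 2 * hq3
    have p2 : (1 - q) ^ n = q := by
      rw [← hinv, inv_pow, p1]
      apply inv_eq_of_mul_eq_one_right
      linear_combination -hq3
    rw [p2] at e1
    rw [p1] at e2
    have hq2 : q + 1 ≠ 0 := by
      intro h
      apply h3
      linear_combination hq1 - (q - 2) * h
    have : hassePoly n q⁻¹ = 0 := by
      apply mul_left_cancel₀ hq2
      apply mul_left_cancel₀ hq0
      linear_combination e2 - e1
    rw [e1, this, mul_zero]
  have hL := hassePoly_landen hp hu (x := k) (z := 4 * (2 - r))
    (by linear_combination (4 * (2 - r)) * hkr - 4 * k * hr)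
  rw [← hq, hA] at hL
  refine (mul_eq_zero.mp hL).resolve_left (pow_ne_zero _ fun h => ?_)
  apply one_ne_zero (α := K)
  have hk1 : k = -1 := by linear_combination h
  rw [hk1] at hkr
  linear_combination hr - (r - 2) * hkr

/-! ### Square roots and products modulo p². -/

theorem exists_sq_eq_zmod_sq {p : ℕ} (hp : p.Prime) (hp2 : p ≠ 2) {d : ℕ} (hd : d.Coprime p)
    {e : ℤ} (he : e = d ∨ e = -d) (h : IsSquare (e : ZMod p)) :
    ∃ r : ZMod (p ^ 2), r ^ 2 = e := by
  obtain ⟨y, hy⟩ := h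
  have : NeZero p := ⟨hp.ne_zero⟩
  obtain ⟨t, rfl⟩ := ZMod.natCast_zmod_surjective (n := p) y
  have hdvd : (p : ℤ) ∣ (t : ℤ) ^ 2 - e := by
    rw [← ZMod.intCast_zmod_eq_zero_iff_dvd]
    push_cast
    rw [hy]
    ring
  have ht : t.Coprime p := by
    rw [Nat.coprime_comm, hp.coprime_iff_not_dvd]
    intro hpt
    have h1 : (p : ℤ) ∣ (t : ℤ) ^ 2 := dvd_pow (Int.natCast_dvd_natCast.mpr hpt) two_ne_zero
    have h2 : (p : ℤ) ∣ e := (dvd_sub_right h1).mp hdvd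
    have h3 : (p : ℤ) ∣ d := by
      rcases he with rfl | rfl
      · exact h2
      · exact (dvd_neg).mp h2
    exact (hp.coprime_iff_not_dvd.mp hd.symm) (Int.natCast_dvd_natCast.mp h3)
  have h2 : (2 : ℕ).Coprime p := (Nat.coprime_primes Nat.prime_two hp).mpr hp2.symm
  obtain ⟨b, hb⟩ := isUnit_iff_exists_inv.mp (isUnit_natCast_zmod_sq (h2.mul_left ht))
  obtain ⟨m, hm⟩ := hdvd
  have hm' : (t : ZMod (p ^ 2)) ^ 2 - e = p * m := by
    exact_mod_cast congrArg (Int.cast (R := ZMod (p ^ 2))) hm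
  -- One Newton step from the root t modulo p, with b the inverse of 2t.
  refine ⟨t - p * m * b, ?_⟩
  push_cast at hb
  linear_combination hm' - p * m * hb + (m * b) ^ 2 * natCast_self_sq_zmod_sq p

theorem mul_eq_zero_of_castHom_eq_zero {p : ℕ} {a b : ZMod (p ^ 2)}
    (ha : ZMod.castHom (dvd_pow_self p two_ne_zero) (ZMod p) a = 0)
    (hb : ZMod.castHom (dvd_pow_self p two_ne_zero) (ZMod p) b = 0) : a * b = 0 := by
  obtain ⟨x, rfl⟩ := ZMod.intCast_surjective a
  obtain ⟨y, rfl⟩ := ZMod.intCast_surjective b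
  rw [map_intCast, ZMod.intCast_zmod_eq_zero_iff_dvd] at ha hb
  rw [← Int.cast_mul, ZMod.intCast_zmod_eq_zero_iff_dvd, Nat.cast_pow, sq]
  exact mul_dvd_mul ha hb

theorem two_mul_add_one_eq_zero_of_charP (R : Type*) [CommRing R] {n : ℕ} [CharP R (2 * n + 1)] :
    (2 * n + 1 : R) = 0 := by
  exact_mod_cast CharP.cast_eq_zero R (2 * n + 1)

theorem natCast_ne_zero_of_charP (R : Type*) [CommRing R] {n : ℕ} [CharP R (2 * n + 1)] (j : ℕ)
    (h0 : 0 < j) (hj : j ≤ n) : (j : R) ≠ 0 := by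
  rw [Ne, CharP.cast_eq_zero_iff R (2 * n + 1)]
  exact fun h => by have := Nat.le_of_dvd h0 h; omega

/-- If `c s_k = z^k + e w^k`, then the combination of coefficients weighted by `s_k` is, up to the
factor `c`, the combination of values of `betaPoly`. -/
theorem mul_sum_eq_betaPoly {R : Type*} [CommRing R] (n : ℕ) (s : ℕ → ℤ) {c z w e : R}
    (h : ∀ k, c * (s k : R) = z ^ k + e * w ^ k) :
    c * ∑ k ∈ Finset.range (n + 1), (n.choose k : R) * (-1) ^ k * (betaMoment n k 0 : R) * (s k : R)
      = betaPoly n z + e * betaPoly n w := by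
  unfold betaPoly
  rw [Finset.mul_sum, Finset.mul_sum, ← Finset.sum_add_distrib]
  refine Finset.sum_congr rfl fun k _ => ?_
  rw [neg_pow z, neg_pow w]
  linear_combination (n.choose k : R) * (-1) ^ k * (betaMoment n k 0 : R) * h k

/-! ### The four congruences. -/

/-- z = 2 is fixed by z ↦ z/(z-1), and (1-2)^n = -1 for odd n. -/
theorem ratModEq_binomSum_neg_eight {n : ℕ} (hp : (2 * n + 1).Prime) (hn : Odd n) :
    RatModEq ((2 * n + 1) ^ 2) (binomSum (2 * n + 1) fun k => 1 / (-8 : ℚ) ^ k) 0 := by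
  have u2 : IsUnit ((2 : ℕ) : ZMod ((2 * n + 1) ^ 2)) := isUnit_natCast_zmod_sq (by simp)
  refine ratModEq_binomSum hp _ (fun k => 2 ^ k) (fun k => ?_) ?_
  · rw [show (-16 : ℚ) = -8 * 2 by norm_num, mul_pow]
    push_cast
    field_simp
  · have h := mul_sum_eq_betaPoly (R := ZMod ((2 * n + 1) ^ 2)) n (fun k => 2 ^ k)
      (c := 1) (z := 2) (w := 0) (e := 0) (fun k => by push_cast; ring)
    rw [one_mul, zero_mul, add_zero] at h
    rw [h, ← u2.mul_right_eq_zero]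
    have := betaPoly_pfaff n (z := (2 : ZMod ((2 * n + 1) ^ 2))) (w := 2) (by ring)
    rw [show (1 : ZMod ((2 * n + 1) ^ 2)) - 2 = -1 by ring, hn.neg_one_pow] at this
    push_cast
    linear_combination this

theorem legendreSym_three_add_three (k : ℕ) :
    legendreSym 3 ((k + 3 : ℕ) : ℤ) = legendreSym 3 (k : ℤ) := by
  rw [legendreSym.mod 3 ((k + 3 : ℕ) : ℤ), legendreSym.mod 3 (k : ℤ)]
  push_cast
  rw [Int.add_emod_right]

/-- A Binet formula: z and 1-z are the roots of X² - X + 1, whose cubes are -1. -/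
theorem legendreSym_three_eq {R : Type*} [CommRing R] {z : R} (hz : z ^ 2 - z + 1 = 0) :
    ∀ k : ℕ, (1 - 2 * z) * (((-1) ^ k * legendreSym 3 (k : ℤ) : ℤ) : R) =
      z ^ k + -1 * (1 - z) ^ k
  | 0 => by simp [legendreSym.at_zero]
  | 1 => by simp [legendreSym.at_one]; ring
  | 2 => by
    have : legendreSym 3 ((2 : ℕ) : ℤ) = -1 := by norm_num
    rw [this]
    push_cast
    ring
  | k + 3 => by
    have ih := legendreSym_three_eq hz k
    rw [legendreSym_three_add_three]
    push_cast at ih ⊢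
    have h1 : z ^ 3 = -1 := by linear_combination (z + 1) * hz
    have h2 : (1 - z) ^ 3 = -1 := by linear_combination (2 - z) * hz
    rw [pow_add z, pow_add (1 - z), h1, h2]
    linear_combination -ih

theorem ratModEq_binomSum_legendreSym {n : ℕ} (hp : (2 * n + 1).Prime) (hn : n % 6 = 0) :
    RatModEq ((2 * n + 1) ^ 2)
      (binomSum (2 * n + 1) fun k => (legendreSym 3 (k : ℤ) : ℚ) / (16 : ℚ) ^ k) 0 := by
  have u2 : IsUnit ((2 : ℕ) : ZMod ((2 * n + 1) ^ 2)) := isUnit_natCast_zmod_sq (by simp)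
  have := Fact.mk hp
  have hn0 : n ≠ 0 := by rintro rfl; exact Nat.not_prime_one hp
  have c3 : (3 : ℕ).Coprime (2 * n + 1) :=
    (Nat.coprime_primes Nat.prime_three hp).mpr (by omega)
  have u3 : IsUnit ((3 : ℕ) : ZMod ((2 * n + 1) ^ 2)) := isUnit_natCast_zmod_sq c3
  have hsq : IsSquare (((-3 : ℤ)) : ZMod (2 * n + 1)) := by
    have h1 : IsSquare (-1 : ZMod (2 * n + 1)) := by
      rw [ZMod.exists_sq_eq_neg_one_iff]; omega
    have h3 : IsSquare ((3 : ℕ) : ZMod (2 * n + 1)) := by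
      rw [ZMod.exists_sq_eq_prime_iff_of_mod_four_eq_one (by omega) (by norm_num)]
      rw [← ZMod.natCast_mod, show (2 * n + 1) % 3 = 1 by omega]
      simp
    have := h1.mul h3
    push_cast at this ⊢
    simpa using this
  obtain ⟨r, hr⟩ := exists_sq_eq_zmod_sq hp (by omega) c3 (e := -3) (Or.inr rfl) hsq
  obtain ⟨b, hb⟩ := isUnit_iff_exists_inv.mp u2
  push_cast at hr hb
  -- z = (1 + √-3)/2, as b is the inverse of 2.
  obtain ⟨z, hz⟩ : ∃ z, z = (1 + r) * b := ⟨_, rfl⟩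
  have hz2 : 2 * z = 1 + r := by rw [hz]; linear_combination (1 + r) * hb
  have hzq : z ^ 2 - z + 1 = 0 := by
    rw [← (u2.pow 2).mul_right_eq_zero]
    push_cast
    linear_combination (2 * z - 1 + r) * hz2 + hr
  refine ratModEq_binomSum hp _ (fun k => (-1) ^ k * legendreSym 3 (k : ℤ)) (fun k => ?_) ?_
  · push_cast
    rw [neg_pow (16 : ℚ), mul_div_mul_left _ _ (pow_ne_zero _ (by norm_num))]
  · have u : IsUnit (1 - 2 * z) := by
      refine isUnit_of_mul_isUnit_left (y := 1 - 2 * z) ?_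
      rw [show (1 - 2 * z) * (1 - 2 * z) = -((3 : ℕ) : ZMod ((2 * n + 1) ^ 2)) by
        push_cast; linear_combination 4 * hzq]
      exact u3.neg
    rw [← u.mul_right_eq_zero, mul_sum_eq_betaPoly n _ (legendreSym_three_eq hzq),
      betaPoly_pfaff n (z := z) (w := 1 - z) (by linear_combination hzq)]
    obtain ⟨m, rfl⟩ : ∃ m, n = 6 * m := ⟨n / 6, by omega⟩
    -- Since 6 divides n, the Pfaff factor (1-z)^n is 1 and the two values cancel.
    have h6 : (1 - z) ^ 6 = 1 := by
      linear_combination ((1 - z) ^ 3 - 1) * (2 - z) * hzq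
    rw [pow_mul, h6]
    simp

theorem pellNumber_eq {R : Type*} [CommRing R] {r : R} (hr : r ^ 2 = 2) :
    ∀ k : ℕ, 2 * r * (((-2) ^ k * pellNumber k : ℤ) : R) =
      (-2 * (1 + r)) ^ k + -1 * (-2 * (1 - r)) ^ k
  | 0 => by simp [pellNumber]
  | 1 => by simp [pellNumber]; ring
  | k + 2 => by
    have h1 := pellNumber_eq hr k
    have h2 := pellNumber_eq hr (k + 1)
    rw [pellNumber]
    push_cast at h1 h2 ⊢
    have e1 : (-2 * (1 + r)) ^ 2 = -4 * (-2 * (1 + r)) + 4 := by linear_combination 4 * hr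
    have e2 : (-2 * (1 - r)) ^ 2 = -4 * (-2 * (1 - r)) + 4 := by linear_combination 4 * hr
    rw [pow_add (-2 * (1 + r)), pow_add (-2 * (1 - r)), e1, e2]
    linear_combination -4 * h2 + 4 * h1

theorem ratModEq_binomSum_pellNumber {n : ℕ} (hp : (2 * n + 1).Prime) (hn : n % 4 = 3) :
    RatModEq ((2 * n + 1) ^ 2)
      (binomSum (2 * n + 1) fun k => (pellNumber k : ℚ) / (8 : ℚ) ^ k) 0 := by
  have u2 : IsUnit ((2 : ℕ) : ZMod ((2 * n + 1) ^ 2)) := isUnit_natCast_zmod_sq (by simp)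
  have := Fact.mk hp
  have hsq : IsSquare ((2 : ℤ) : ZMod (2 * n + 1)) := by
    push_cast
    rw [ZMod.exists_sq_eq_two_iff (by omega)]
    omega
  obtain ⟨r, hr⟩ := exists_sq_eq_zmod_sq hp (by omega) (d := 2) (by simp) (e := 2) (Or.inl rfl) hsq
  push_cast at hr
  refine ratModEq_binomSum hp _ (fun k => (-2) ^ k * pellNumber k) (fun k => ?_) ?_
  · push_cast
    rw [show (-16 : ℚ) = -2 * 8 by norm_num, mul_pow,
      mul_div_mul_left _ _ (pow_ne_zero _ (by norm_num))]
  · have u : IsUnit (2 * r) := by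
      refine isUnit_of_mul_isUnit_left (y := r) ?_
      rw [show 2 * r * r = ((2 : ℕ) : ZMod ((2 * n + 1) ^ 2)) ^ 2 by
        push_cast; linear_combination 2 * hr]
      exact u2.pow 2
    rw [← u.mul_right_eq_zero, mul_sum_eq_betaPoly n _ (pellNumber_eq hr),
      betaPoly_pfaff n (z := -2 * (1 + r)) (w := -2 * (1 - r)) (by linear_combination 4 * hr)]
    -- Each factor is only divisible by p: the first by Fermat, as 1-z = (1+√2)², the second by
    -- supersingularity at w = 2(√2-1).
    rw [show ∀ a b : ZMod ((2 * n + 1) ^ 2), a * b + -1 * b = (a - 1) * b by intros; ring]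
    set f := ZMod.castHom (dvd_pow_self (2 * n + 1) two_ne_zero) (ZMod (2 * n + 1))
    have hfr : f r ^ 2 = 2 := by rw [← map_pow, hr]; exact map_ofNat f _
    have hP := two_mul_add_one_eq_zero_of_charP (ZMod (2 * n + 1)) (n := n)
    have fermat : ∀ x : ZMod (2 * n + 1), x ≠ 0 → x ^ (2 * n) = 1 := fun x hx => by
      simpa using ZMod.pow_card_sub_one_eq_one hx
    refine mul_eq_zero_of_castHom_eq_zero ?_ ?_
    · change f _ = 0
      have hα : 1 + f r ≠ 0 := by
        intro h
        apply one_ne_zero (α := ZMod (2 * n + 1))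
        linear_combination (f r - 1) * h - hfr
      have := fermat _ hα
      rw [pow_mul] at this
      simp only [map_sub, map_pow, map_mul, map_add, map_neg, map_one, map_ofNat]
      rw [show 1 - -2 * (1 + f r) = (1 + f r) ^ 2 by linear_combination -hfr, this, sub_self]
    · change f _ = 0
      have h2 : (2 : ZMod (2 * n + 1)) ≠ 0 := by
        exact_mod_cast natCast_ne_zero_of_charP (ZMod (2 * n + 1)) 2 (by norm_num) (by omega)
      have hr0 : f r ≠ 0 := by
        intro h
        rw [h] at hfr
        exact h2 (by rw [← hfr]; simp)
      rw [map_betaPoly, betaPoly_eq_factorial_mul_hassePoly hP]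
      simp only [map_sub, map_mul, map_neg, map_one, map_ofNat]
      rw [show -2 * (1 - f r) = 2 * (f r - 1) by ring,
        hassePoly_sqrt_two hP (natCast_ne_zero_of_charP _) (Nat.odd_iff.mpr (by omega)) hfr
          (fermat _ hr0), mul_zero]

theorem seqR_eq {R : Type*} [CommRing R] {r : R} (hr : r ^ 2 = 3) :
    ∀ k : ℕ, 1 * ((4 ^ k * seqR k : ℤ) : R) = (4 * (2 + r)) ^ k + 1 * (4 * (2 - r)) ^ k
  | 0 => by simp [seqR]; norm_num
  | 1 => by simp [seqR]; ring
  | k + 2 => by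
    have h1 := seqR_eq hr k
    have h2 := seqR_eq hr (k + 1)
    rw [seqR]
    push_cast at h1 h2 ⊢
    have e1 : (4 * (2 + r)) ^ 2 = 16 * (4 * (2 + r)) - 16 := by linear_combination 16 * hr
    have e2 : (4 * (2 - r)) ^ 2 = 16 * (4 * (2 - r)) - 16 := by linear_combination 16 * hr
    rw [pow_add (4 * (2 + r)), pow_add (4 * (2 - r)), e1, e2]
    linear_combination 16 * h2 - 16 * h1

theorem ratModEq_binomSum_seqR {n : ℕ} (hp : (2 * n + 1).Prime) (hn : n % 6 = 5) :
    RatModEq ((2 * n + 1) ^ 2)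
      (binomSum (2 * n + 1) fun k => (seqR k : ℚ) / (-4 : ℚ) ^ k) 0 := by
  have := Fact.mk hp
  have c3 : (3 : ℕ).Coprime (2 * n + 1) :=
    (Nat.coprime_primes Nat.prime_three hp).mpr (by omega)
  have hsq : IsSquare ((3 : ℤ) : ZMod (2 * n + 1)) := by
    have : IsSquare ((3 : ℕ) : ZMod (2 * n + 1)) := by
      rw [ZMod.exists_sq_eq_prime_iff_of_mod_four_eq_three (by omega) (by norm_num) (by omega),
        ← ZMod.natCast_mod, show (2 * n + 1) % 3 = 2 by omega]
      decide
    exact_mod_cast this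
  obtain ⟨r, hr⟩ := exists_sq_eq_zmod_sq hp (by omega) c3 (e := 3) (Or.inl rfl) hsq
  push_cast at hr
  refine ratModEq_binomSum hp _ (fun k => 4 ^ k * seqR k) (fun k => ?_) ?_
  · push_cast
    rw [show (-16 : ℚ) = 4 * -4 by norm_num, mul_pow,
      mul_div_mul_left _ _ (pow_ne_zero _ (by norm_num))]
  · have h := mul_sum_eq_betaPoly n _ (seqR_eq hr)
    rw [one_mul] at h
    rw [h, betaPoly_pfaff n (z := 4 * (2 + r)) (w := 4 * (2 - r)) (by linear_combination 16 * hr)]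
    -- Here 1-z = -(2+√3)² and n is odd, so Fermat gives (1-z)^n ≡ -1 modulo p.
    rw [show ∀ a b : ZMod ((2 * n + 1) ^ 2), a * b + 1 * b = (a + 1) * b by intros; ring]
    set f := ZMod.castHom (dvd_pow_self (2 * n + 1) two_ne_zero) (ZMod (2 * n + 1))
    have hfr : f r ^ 2 = 3 := by rw [← map_pow, hr]; exact map_ofNat f _
    refine mul_eq_zero_of_castHom_eq_zero ?_ ?_
    · change f _ = 0
      have hα : 2 + f r ≠ 0 := by
        intro h
        apply one_ne_zero (α := ZMod (2 * n + 1))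
        linear_combination (2 - f r) * h + hfr
      have : (2 + f r) ^ (2 * n) = 1 := by simpa using ZMod.pow_card_sub_one_eq_one hα
      rw [pow_mul] at this
      simp only [map_sub, map_pow, map_mul, map_add, map_one, map_ofNat]
      rw [show 1 - 4 * (2 + f r) = -(2 + f r) ^ 2 by linear_combination hfr,
        (Nat.odd_iff.mpr (by omega) : Odd n).neg_pow, this, neg_add_cancel]
    · change f _ = 0
      -- The supersingularity argument needs √-1, which is absent from the prime field as p ≡ 3
      -- modulo 4.
      let K := AlgebraicClosure (ZMod (2 * n + 1))
      have : CharP K (2 * n + 1) := charP_of_injective_algebraMap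
        (algebraMap (ZMod (2 * n + 1)) K).injective _
      have hP := two_mul_add_one_eq_zero_of_charP K (n := n)
      apply (algebraMap (ZMod (2 * n + 1)) K).injective
      rw [map_betaPoly, map_betaPoly, betaPoly_eq_factorial_mul_hassePoly hP, map_zero]
      simp only [map_sub, map_mul, map_ofNat]
      rw [hassePoly_sqrt_three hP (natCast_ne_zero_of_charP _) hn (by rw [← map_pow, hfr]; exact map_ofNat _ _),
        mul_zero]

theorem theorem1 (p : ℕ) (hp : p.Prime) :
    (p % 4 = 3 →
      RatModEq (p ^ 2) (binomSum p fun k => 1 / (-8 : ℚ) ^ k) 0) ∧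
    (p % 12 = 1 →
      RatModEq (p ^ 2) (binomSum p fun k => (legendreSym 3 (k : ℤ) : ℚ) / (16 : ℚ) ^ k) 0) ∧
    (p % 8 = 7 →
      RatModEq (p ^ 2) (binomSum p fun k => (pellNumber k : ℚ) / (8 : ℚ) ^ k) 0) ∧
    (p % 12 = 11 →
      RatModEq (p ^ 2) (binomSum p fun k => (seqR k : ℚ) / (-4 : ℚ) ^ k) 0) := by
  rcases hp.eq_two_or_odd with rfl | hodd
  · simp
  · obtain ⟨n, rfl⟩ : ∃ n, p = 2 * n + 1 := ⟨p / 2, by omega⟩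
    exact ⟨fun h => ratModEq_binomSum_neg_eight hp (Nat.odd_iff.mpr (by omega)),
      fun h => ratModEq_binomSum_legendreSym hp (by omega),
      fun h => ratModEq_binomSum_pellNumber hp (by omega),
      fun h => ratModEq_binomSum_seqR hp (by omega)⟩
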